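/- Let $m,n\ge 1$ and let $m_s\in\mathbb{R}^{m\times n}$ be fixed. For $X\in\mathbb{R}^{m\times n}$ write $\|X\|_1=\sum_{i,j}|X_{ij}|$, let $\|X\|_*$ be the nuclear norm (the sum of the singular values of $X$), and let $\|X\|_{op}$ be the operator norm with respect to the Euclidean norms (the largest singular value). Consider the problem $$\min_{m_c\in\mathbb{R}^{m\times n}} \|m_c\|_1\quad\text{subject to}\quad \operatorname{rank}(m_c)>\operatorname{rank}(m_s),\tag{P}$$ the problem obtained from it by replacing the rank by the nuclear norm, $$\min_{m_c\in\mathbb{R}^{m\times n}} \|m_c\|_1\quad\text{subject to}\quad \|m_c\|_*>\|m_s\|_*,\tag{R}$$ and, for $\lambda\ge 0$, the penalty function $$\mathcal L(m_c,m_s,\lambda)=\|m_c\|_1+\lambda\max(0,\|m_s\|_*-\|m_c\|_*).$$ Since the constraint of (R) is strict, its minimum is understood as the infimum $v$ of $\|\cdot\|_1$ over its feasible set, and a solution of (R) is a matrix in the closure of the feasible set whose $\ell_1$-norm equals $v$. Then: 1. (P) is non-convex because of the rank constraint: the objective $\|\cdot\|_1$ is convex, but $\operatorname{rank}$ is not a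 convex function on $\mathbb{R}^{m\times n}$, and the feasible set of (P), if non-empty, is not convex. 2. The nuclear norm is the convex envelope of the rank on the ball $B=\{X:\|X\|_{op}\le 1\}$: it is convex on $B$, satisfies $\|X\|_*\le\operatorname{rank}(X)$ for $X\in B$, and every convex $h:B\to\mathbb{R}$ with $h\le\operatorname{rank}$ on $B$ satisfies $h(X)\le\|X\|_*$ for all $X\in B$. 3. The penalty formulation enforces the constraint of (R), up to its boundary, as $\lambda\to\infty$: (a) if $\|m_c\|_*\ge\|m_s\|_*$, then $\mathcal L(m_c,m_s,\lambda)=\|m_c\|_1$ for all $\lambda$; if $\|m_c\|_*<\|m_s\|_*$, then $\mathcal L(m_c,m_s,\lambda)\to\infty$ as $\lambda\to\infty$; (b) for every $\lambda\ge 0$ the function $\mathcal L(\cdot,m_s,\lambda)$ has a minimiser over $\mathbb{R}^{m\times n}$; the feasible set of (R) is non-empty, its infimum $v$ is finite, and (R) has a solution; (c) if $\lambda_k\to\infty$ and, for each $k$, $X_k$ is a minimiser of $\mathcal L(\cdot,m_s,\lambda_k)$, then $\|X_k\|_*\ge\|m_s\|_*$ for all sufficiently large $k$, $\mathcal L(X_k,m_s,\lambda_k)\to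 v$, $\|X_k\|_1\to v$, and $X_k$ converges to the set of solutions of (R) (every open set containing all solutions of (R) contains $X_k$ for all sufficiently large $k$). -/

import Mathlib

open Filter Topology

noncomputable section

namespace MergerRelaxation

variable {m n : ℕ}

/-- The entrywise `ℓ¹` norm of a real matrix. -/
def l1Norm (X : Matrix (Fin m) (Fin n) ℝ) : ℝ :=
  ∑ i, ∑ j, |X i j|

/-- The rank, as a real-valued function. -/
def rankFn (X : Matrix (Fin m) (Fin n) ℝ) : ℝ :=
  (X.rank : ℝ)

/-- The nuclear norm: the sum of the singular values of the matrix, seen as a linear map between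
Euclidean spaces. (Singular values with index at least `n` vanish.) -/
def nuclearNorm (X : Matrix (Fin m) (Fin n) ℝ) : ℝ :=
  ∑ i ∈ Finset.range n, (Matrix.toEuclideanLin X).singularValues i

/-- The closed unit ball of the (Euclidean) operator norm. -/
def opUnitBall (m n : ℕ) : Set (Matrix (Fin m) (Fin n) ℝ) :=
  {X | ‖(Matrix.toEuclideanLin X).toContinuousLinearMap‖ ≤ 1}

/-- `g` is the convex envelope of `f` on `s`: the largest convex function on `s` below `f`. -/
def IsConvexEnvelopeOn {E : Type*} [AddCommGroup E] [Module ℝ E]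
    (s : Set E) (f g : E → ℝ) : Prop :=
  ConvexOn ℝ s g ∧ (∀ x ∈ s, g x ≤ f x) ∧
    ∀ h : E → ℝ, ConvexOn ℝ s h → (∀ x ∈ s, h x ≤ f x) → ∀ x ∈ s, h x ≤ g x

/-- The feasible set of the constraint `f X > f S`. It is used with `f` the rank (the original
problem) and with `f` the nuclear norm (the relaxed problem). -/
def feasible (f : Matrix (Fin m) (Fin n) ℝ → ℝ) (S : Matrix (Fin m) (Fin n) ℝ) :
    Set (Matrix (Fin m) (Fin n) ℝ) :=
  {X | f S < f X}

/-- The solutions of `min ‖X‖₁` subject to `‖X‖_* > ‖S‖_*`. As the constraint is strict, these are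
the limits of feasible matrices at which the infimum of the objective over the feasible set is
taken. -/
def relaxedSolutions (S : Matrix (Fin m) (Fin n) ℝ) : Set (Matrix (Fin m) (Fin n) ℝ) :=
  {X | X ∈ closure (feasible nuclearNorm S) ∧
    IsGLB (l1Norm '' feasible nuclearNorm S) (l1Norm X)}

/-- The penalty function `‖X‖₁ + t * max (0, ‖S‖_* - ‖X‖_*)`. -/
def penalty (X S : Matrix (Fin m) (Fin n) ℝ) (t : ℝ) : ℝ :=
  l1Norm X + t * max 0 (nuclearNorm S - nuclearNorm X)

/-- `X` minimises the penalty function with parameter `t` over all matrices. -/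
def IsPenaltyMinimizer (S : Matrix (Fin m) (Fin n) ℝ) (t : ℝ)
    (X : Matrix (Fin m) (Fin n) ℝ) : Prop :=
  ∀ Y, penalty X S t ≤ penalty Y S t

end MergerRelaxation

end

/-! The convexity of the nuclear norm comes from duality: the sum of the singular values of `T` is
the maximum of `tr (W* T)` over contractions `W`, attained by matching right singular vectors to
left ones. A maximum of linear functionals is subadditive and homogeneous; continuity follows from
convexity.

For the envelope, fix the singular vectors of `X` and let the singular values `s` vary. This maps
the unit cube linearly into the operator ball, and at a 0/1 vertex the rank is at most `∑ s i`. A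
convex `h` below the rank is thus below a linear function at the vertices, hence on the whole cube,
in particular at `X`.

The penalty is exact. As `‖X‖₁ ≤ mn ‖X‖_*`, for a parameter above `mn` it pays to scale an
infeasible nonzero `X` up to the boundary. Minimisers are then feasible and so are solutions of the
relaxed problem; all the limits are limits of eventually constant or eventually contained sequences.
-/

namespace MergerRelaxation

open scoped InnerProductSpace

/-! ### Singular value decomposition and trace duality -/

section SingularValueDecomposition

variable {E F : Type*} [NormedAddCommGroup E] [InnerProductSpace ℝ E]
  [NormedAddCommGroup F] [InnerProductSpace ℝ F] {d : ℕ}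

theorem norm_constr_apply_le (b : OrthonormalBasis (Fin d) ℝ E) {u : Fin d → F}
    (hu : ∀ i j, i ≠ j → ⟪u i, u j⟫_ℝ = 0) (hu' : ∀ i, ‖u i‖ ≤ 1) (x : E) :
    ‖b.toBasis.constr ℝ u x‖ ≤ ‖x‖ := by
  refine (sq_le_sq₀ (norm_nonneg _) (norm_nonneg _)).mp ?_
  have h : b.toBasis.constr ℝ u x = ∑ i, ⟪b i, x⟫_ℝ • u i := by
    simp [Module.Basis.constr_apply_fintype, OrthonormalBasis.repr_apply_apply]
  have h2 : ‖∑ i, ⟪b i, x⟫_ℝ • u i‖ ^ 2 = ∑ i, ⟪b i, x⟫_ℝ ^ 2 * ‖u i‖ ^ 2 := by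
    rw [← real_inner_self_eq_norm_sq, sum_inner]
    refine Finset.sum_congr rfl fun i _ => ?_
    rw [inner_sum, Finset.sum_eq_single i]
    · rw [inner_smul_left, inner_smul_right, real_inner_self_eq_norm_sq]
      simp only [conj_trivial]
      ring
    · intro j _ hj
      rw [inner_smul_left, inner_smul_right, hu i j hj.symm, mul_zero, mul_zero]
    · simp
  rw [h, h2, ← b.sum_sq_inner_right x]
  refine Finset.sum_le_sum fun i _ => ?_
  exact mul_le_of_le_one_right (sq_nonneg _) (pow_le_one₀ (norm_nonneg _) (hu' i))

variable [FiniteDimensional ℝ E] [FiniteDimensional ℝ F]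

/-- A singular value decomposition, with left singular vectors that are orthogonal and of norm one,
or zero where the singular value vanishes. -/
theorem exists_singularValueDecomposition (hd : Module.finrank ℝ E = d) (T : E →ₗ[ℝ] F) :
    ∃ (b : OrthonormalBasis (Fin d) ℝ E) (u : Fin d → F),
      (∀ i, T (b i) = T.singularValues i • u i) ∧ (∀ i j, i ≠ j → ⟪u i, u j⟫_ℝ = 0) ∧
      (∀ i, ‖u i‖ ≤ 1) ∧ ∀ i, ⟪u i, T (b i)⟫_ℝ = T.singularValues i := by
  have hsymm := T.isSymmetric_adjoint_comp_self
  set b := hsymm.eigenvectorBasis hd with hb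
  have hinner : ∀ i j, ⟪T (b i), T (b j)⟫_ℝ = if i = j then T.singularValues i ^ 2 else 0 := by
    intro i j
    have h : (LinearMap.adjoint T) (T (b j)) = T.singularValues j ^ 2 • b j := by
      rw [T.sq_singularValues_fin hd]
      exact hsymm.apply_eigenvectorBasis hd j
    rw [← LinearMap.adjoint_inner_right, h, inner_smul_right,
      orthonormal_iff_ite.mp b.orthonormal i j]
    split_ifs with hij
    · rw [hij, mul_one]
    · rw [mul_zero]
  have hnorm : ∀ i, ‖T (b i)‖ = T.singularValues i := by
    intro i
    have h := hinner i i
    rw [real_inner_self_eq_norm_sq, if_pos rfl] at h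
    exact (sq_eq_sq₀ (norm_nonneg _) (T.singularValues_nonneg i)).mp h
  -- Since `0⁻¹ = 0`, this normalisation gives the zero vector when the singular value vanishes.
  refine ⟨b, fun i => (T.singularValues i)⁻¹ • T (b i), fun i => ?_, fun i j hij => ?_,
    fun i => ?_, fun i => ?_⟩
  · rcases eq_or_ne (T.singularValues i) 0 with h | h
    · rw [h, zero_smul, ← norm_eq_zero, hnorm, h]
    · rw [smul_inv_smul₀ h]
  · rw [inner_smul_left, inner_smul_right, hinner, if_neg hij, mul_zero, mul_zero]
  · rw [norm_smul, hnorm, norm_inv, Real.norm_of_nonneg (T.singularValues_nonneg i)]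
    exact inv_mul_le_one
  · rw [inner_smul_left, hinner, if_pos rfl]
    rcases eq_or_ne (T.singularValues i) 0 with h | h
    · simp [h]
    · simp [pow_two, h]

/-- In the basis of right singular vectors the trace has terms `σ i * ⟪W (b i), u i⟫`, each at most
`σ i` by Cauchy–Schwarz. -/
theorem trace_adjoint_comp_le_sum_singularValues (hd : Module.finrank ℝ E = d) (T W : E →ₗ[ℝ] F)
    (hW : ∀ x, ‖W x‖ ≤ ‖x‖) :
    LinearMap.trace ℝ E (LinearMap.adjoint W ∘ₗ T) ≤ ∑ i : Fin d, T.singularValues i := by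
  obtain ⟨b, u, hTb, -, hu, -⟩ := exists_singularValueDecomposition hd T
  rw [LinearMap.trace_eq_sum_inner _ b]
  refine Finset.sum_le_sum fun i _ => ?_
  rw [LinearMap.comp_apply, LinearMap.adjoint_inner_right, hTb, inner_smul_right]
  refine mul_le_of_le_one_right (T.singularValues_nonneg i) ((real_inner_le_norm _ _).trans ?_)
  exact mul_le_one₀ ((hW _).trans_eq (b.orthonormal.norm_eq_one i)) (norm_nonneg _) (hu i)

theorem exists_trace_adjoint_comp_eq_sum_singularValues (hd : Module.finrank ℝ E = d)
    (T : E →ₗ[ℝ] F) :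
    ∃ W : E →ₗ[ℝ] F, (∀ x, ‖W x‖ ≤ ‖x‖) ∧
      LinearMap.trace ℝ E (LinearMap.adjoint W ∘ₗ T) = ∑ i : Fin d, T.singularValues i := by
  obtain ⟨b, u, hTb, hu, hu', hT⟩ := exists_singularValueDecomposition hd T
  refine ⟨b.toBasis.constr ℝ u, norm_constr_apply_le b hu hu', ?_⟩
  rw [LinearMap.trace_eq_sum_inner _ b]
  refine Finset.sum_congr rfl fun i _ => ?_
  have h : b.toBasis.constr ℝ u (b i) = u i := by
    rw [← b.coe_toBasis, Module.Basis.constr_basis]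
  rw [LinearMap.comp_apply, LinearMap.adjoint_inner_right, h, hT]

theorem singularValues_le_of_norm_apply_le {T : E →ₗ[ℝ] F} {C : ℝ} (hC : 0 ≤ C)
    (hT : ∀ x, ‖T x‖ ≤ C * ‖x‖) (i : ℕ) : T.singularValues i ≤ C := by
  by_cases hi : i < Module.finrank ℝ E
  · obtain ⟨b, u, -, -, hu, hTb⟩ := exists_singularValueDecomposition rfl T
    rw [← hTb ⟨i, hi⟩]
    refine (real_inner_le_norm _ _).trans ?_
    refine (mul_le_of_le_one_left (norm_nonneg _) (hu _)).trans ((hT _).trans_eq ?_)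
    rw [b.orthonormal.norm_eq_one, mul_one]
  · rwa [T.singularValues_of_finrank_le (not_lt.mp hi)]

theorem norm_apply_le_sum_singularValues_mul_norm (hd : Module.finrank ℝ E = d) (T : E →ₗ[ℝ] F)
    (x : E) : ‖T x‖ ≤ (∑ i : Fin d, T.singularValues i) * ‖x‖ := by
  obtain ⟨b, u, hTb, -, hu, -⟩ := exists_singularValueDecomposition hd T
  have h : T x = ∑ i, ⟪b i, x⟫_ℝ • T.singularValues i • u i := by
    conv_lhs => rw [← b.sum_repr' x]
    simp [hTb]
  rw [h, Finset.sum_mul]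
  refine norm_sum_le_of_le _ fun i _ => ?_
  rw [norm_smul, norm_smul, Real.norm_of_nonneg (T.singularValues_nonneg i), mul_comm]
  have h1 : ‖⟪b i, x⟫_ℝ‖ ≤ ‖x‖ := by
    simpa [b.orthonormal.norm_eq_one] using norm_inner_le_norm (𝕜 := ℝ) (b i) x
  exact mul_le_mul (mul_le_of_le_one_right (T.singularValues_nonneg i) (hu i)) h1
    (norm_nonneg _) (T.singularValues_nonneg i)

end SingularValueDecomposition

/-! ### The nuclear norm and the operator norm ball -/

section NuclearNorm

variable {m n : ℕ}

theorem nuclearNorm_eq_sum_fin (X : Matrix (Fin m) (Fin n) ℝ) :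
    nuclearNorm X = ∑ i : Fin n, (Matrix.toEuclideanLin X).singularValues i :=
  (Fin.sum_univ_eq_sum_range (fun i => (Matrix.toEuclideanLin X).singularValues i) n).symm

theorem nuclearNorm_nonneg (X : Matrix (Fin m) (Fin n) ℝ) : 0 ≤ nuclearNorm X :=
  Finset.sum_nonneg fun i _ => LinearMap.singularValues_nonneg _ i

theorem nuclearNorm_zero : nuclearNorm (0 : Matrix (Fin m) (Fin n) ℝ) = 0 := by
  simp [nuclearNorm]

/-- The contraction that is optimal for `X + Y` is admissible for `X` and for `Y`. -/
theorem nuclearNorm_add_le (X Y : Matrix (Fin m) (Fin n) ℝ) :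
    nuclearNorm (X + Y) ≤ nuclearNorm X + nuclearNorm Y := by
  have hd : Module.finrank ℝ (EuclideanSpace ℝ (Fin n)) = n := finrank_euclideanSpace_fin
  obtain ⟨W, hW, h⟩ := exists_trace_adjoint_comp_eq_sum_singularValues hd
    (Matrix.toEuclideanLin (X + Y))
  rw [nuclearNorm_eq_sum_fin, nuclearNorm_eq_sum_fin, nuclearNorm_eq_sum_fin, ← h, map_add,
    LinearMap.comp_add, map_add]
  exact add_le_add (trace_adjoint_comp_le_sum_singularValues hd _ W hW)
    (trace_adjoint_comp_le_sum_singularValues hd _ W hW)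

theorem nuclearNorm_smul_le {c : ℝ} (hc : 0 ≤ c) (X : Matrix (Fin m) (Fin n) ℝ) :
    nuclearNorm (c • X) ≤ c * nuclearNorm X := by
  have hd : Module.finrank ℝ (EuclideanSpace ℝ (Fin n)) = n := finrank_euclideanSpace_fin
  obtain ⟨W, hW, h⟩ := exists_trace_adjoint_comp_eq_sum_singularValues hd
    (Matrix.toEuclideanLin (c • X))
  rw [nuclearNorm_eq_sum_fin, nuclearNorm_eq_sum_fin, ← h, map_smul, LinearMap.comp_smul, map_smul,
    smul_eq_mul]
  exact mul_le_mul_of_nonneg_left (trace_adjoint_comp_le_sum_singularValues hd _ W hW) hc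

theorem nuclearNorm_smul {c : ℝ} (hc : 0 ≤ c) (X : Matrix (Fin m) (Fin n) ℝ) :
    nuclearNorm (c • X) = c * nuclearNorm X := by
  rcases hc.eq_or_lt with rfl | hc'
  · rw [zero_smul, nuclearNorm_zero, zero_mul]
  refine (nuclearNorm_smul_le hc X).antisymm ?_
  have h := nuclearNorm_smul_le (inv_nonneg.mpr hc) (c • X)
  rwa [inv_smul_smul₀ hc'.ne', le_inv_mul_iff₀ hc'] at h

theorem convexOn_nuclearNorm :
    ConvexOn ℝ Set.univ (nuclearNorm (m := m) (n := n)) := by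
  refine ⟨convex_univ, fun X _ Y _ a b ha hb _ => ?_⟩
  refine (nuclearNorm_add_le _ _).trans_eq ?_
  rw [nuclearNorm_smul ha, nuclearNorm_smul hb, smul_eq_mul, smul_eq_mul]

section

attribute [local instance] Matrix.normedAddCommGroup Matrix.normedSpace

theorem continuous_nuclearNorm : Continuous (nuclearNorm (m := m) (n := n)) :=
  convexOn_nuclearNorm.locallyLipschitz.continuous

end

theorem abs_apply_le_nuclearNorm (X : Matrix (Fin m) (Fin n) ℝ) (i : Fin m) (j : Fin n) :
    |X i j| ≤ nuclearNorm X := by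
  have h := norm_apply_le_sum_singularValues_mul_norm finrank_euclideanSpace_fin
    (Matrix.toEuclideanLin X) (EuclideanSpace.single j 1)
  rw [← nuclearNorm_eq_sum_fin, PiLp.norm_single, norm_one, mul_one] at h
  refine le_trans ?_ h
  refine le_trans (le_of_eq ?_) (PiLp.norm_apply_le _ i)
  simp [Matrix.toLpLin_apply]

theorem rank_eq_finrank_range_toEuclideanLin (X : Matrix (Fin m) (Fin n) ℝ) :
    X.rank = Module.finrank ℝ (LinearMap.range (Matrix.toEuclideanLin X)) := by
  rw [Matrix.toEuclideanLin, Matrix.toLpLin_eq_toLin]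
  exact X.rank_eq_finrank_range_toLin _ _

theorem norm_toEuclideanLin_apply_le {X : Matrix (Fin m) (Fin n) ℝ} (hX : X ∈ opUnitBall m n)
    (x : EuclideanSpace ℝ (Fin n)) : ‖Matrix.toEuclideanLin X x‖ ≤ ‖x‖ :=
  (Matrix.toEuclideanLin X).toContinuousLinearMap.le_of_opNorm_le_of_le hX le_rfl |>.trans_eq
    (one_mul _)

theorem mem_opUnitBall_of_norm_apply_le {X : Matrix (Fin m) (Fin n) ℝ}
    (hX : ∀ x, ‖Matrix.toEuclideanLin X x‖ ≤ ‖x‖) : X ∈ opUnitBall m n :=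
  ContinuousLinearMap.opNorm_le_bound _ zero_le_one fun x => (hX x).trans_eq (one_mul _).symm

theorem convex_opUnitBall : Convex ℝ (opUnitBall m n) := by
  intro X hX Y hY a b ha hb hab
  refine mem_opUnitBall_of_norm_apply_le fun x => ?_
  rw [map_add, map_smul, map_smul, LinearMap.add_apply, LinearMap.smul_apply,
    LinearMap.smul_apply]
  refine (norm_add_le _ _).trans ?_
  rw [norm_smul, norm_smul, Real.norm_of_nonneg ha, Real.norm_of_nonneg hb]
  calc a * ‖Matrix.toEuclideanLin X x‖ + b * ‖Matrix.toEuclideanLin Y x‖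
      ≤ a * ‖x‖ + b * ‖x‖ := by
        gcongr
        · exact norm_toEuclideanLin_apply_le hX x
        · exact norm_toEuclideanLin_apply_le hY x
    _ = ‖x‖ := by rw [← add_mul, hab, one_mul]

/-- Singular values are at most one on the ball and vanish from index `X.rank` on. -/
theorem nuclearNorm_le_rankFn {X : Matrix (Fin m) (Fin n) ℝ} (hX : X ∈ opUnitBall m n) :
    nuclearNorm X ≤ rankFn X := by
  set T := Matrix.toEuclideanLin X with hT
  have h1 : ∀ i, T.singularValues i ≤ 1 := fun i =>
    singularValues_le_of_norm_apply_le zero_le_one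
      (fun x => (norm_toEuclideanLin_apply_le hX x).trans_eq (one_mul _).symm) i
  have hle : X.rank ≤ n := X.rank_le_width
  rw [rankFn, nuclearNorm, ← hT,
    ← Finset.sum_subset (Finset.range_subset_range.mpr hle) fun i _ hi => ?_]
  · exact (Finset.sum_le_card_nsmul _ _ 1 fun i _ => h1 i).trans_eq (by simp)
  · rw [T.singularValues_eq_zero_iff_le_finrank_range, hT, ← rank_eq_finrank_range_toEuclideanLin]
    simpa using hi

end NuclearNorm

/-! ### Maximality among convex minorants of the rank -/

section ConvexEnvelope

/-- A convex function on the unit cube that is at most the coordinate sum at the vertices is so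
everywhere. -/
theorem le_sum_of_convexOn_Icc {ι : Type*} [Fintype ι] {g : (ι → ℝ) → ℝ}
    (hg : ConvexOn ℝ (Set.Icc 0 1) g)
    (hvertex : ∀ s : ι → ℝ, (∀ i, s i = 0 ∨ s i = 1) → g s ≤ ∑ i, s i) {s : ι → ℝ}
    (hs : s ∈ Set.Icc 0 1) : g s ≤ ∑ i, s i := by
  classical
  -- Induction on the set `t` of coordinates allowed to be fractional: freeing `j` writes `s` as a
  -- convex combination of its two updates at `j`.
  suffices h : ∀ t : Finset ι, ∀ s ∈ Set.Icc (0 : ι → ℝ) 1, (∀ i ∉ t, s i = 0 ∨ s i = 1) →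
      g s ≤ ∑ i, s i from h Finset.univ s hs fun i hi => absurd (Finset.mem_univ i) hi
  intro t
  induction t using Finset.induction_on with
  | empty => exact fun s _ h => hvertex s fun i => h i (Finset.notMem_empty i)
  | insert j t _ ih =>
    intro s hs h
    have hupdate : ∀ c : ℝ, c = 0 ∨ c = 1 →
        Function.update s j c ∈ Set.Icc (0 : ι → ℝ) 1 ∧
          g (Function.update s j c) ≤ ∑ i, s i - s j + c := by
      intro c hc
      have hmem : Function.update s j c ∈ Set.Icc (0 : ι → ℝ) 1 := by
        refine ⟨fun i => ?_, fun i => ?_⟩ <;> rcases eq_or_ne i j with rfl | hij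
        · rcases hc with rfl | rfl <;> simp
        · simpa [hij] using hs.1 i
        · rcases hc with rfl | rfl <;> simp
        · simpa [hij] using hs.2 i
      refine ⟨hmem, (ih _ hmem fun i hi => ?_).trans_eq ?_⟩
      · rcases eq_or_ne i j with rfl | hij
        · simpa using hc
        · simpa [hij] using h i (by simp [hij, hi])
      · rw [Finset.sum_update_of_mem (Finset.mem_univ j),
          ← Finset.add_sum_erase _ s (Finset.mem_univ j), Finset.sdiff_singleton_eq_erase]
        ring
    have hs0 : 0 ≤ s j := hs.1 j
    have hs1 : s j ≤ 1 := hs.2 j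
    have hcomb : (1 - s j) • Function.update s j 0 + s j • Function.update s j 1 = s := by
      ext i
      rcases eq_or_ne i j with rfl | hij
      · simp
      · simp [hij]
        ring
    have hconv := hg.2 (hupdate 0 (.inl rfl)).1 (hupdate 1 (.inr rfl)).1 (sub_nonneg.mpr hs1) hs0
      (sub_add_cancel 1 (s j))
    rw [hcomb, smul_eq_mul, smul_eq_mul] at hconv
    have h0 := mul_le_mul_of_nonneg_left (hupdate 0 (.inl rfl)).2 (sub_nonneg.mpr hs1)
    have h1 := mul_le_mul_of_nonneg_left (hupdate 1 (.inr rfl)).2 hs0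
    linarith

variable {m n : ℕ}

theorem finrank_range_constr_smul_le {E F : Type*} [AddCommGroup E] [Module ℝ E] [AddCommGroup F]
    [Module ℝ F] {d : ℕ} (b : Module.Basis (Fin d) ℝ E) (u : Fin d → F) {s : Fin d → ℝ}
    (hs : ∀ i, s i = 0 ∨ s i = 1) :
    (Module.finrank ℝ (LinearMap.range (b.constr ℝ fun i => s i • u i)) : ℝ) ≤ ∑ i, s i := by
  classical
  set t : Finset (Fin d) := Finset.univ.filter fun i => s i = 1 with ht
  have hsum : ∑ i, s i = (t.card : ℝ) := by
    rw [ht, Finset.card_filter, Nat.cast_sum]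
    refine Finset.sum_congr rfl fun i _ => ?_
    rcases hs i with h | h <;> simp [h]
  have hle : LinearMap.range (b.constr ℝ fun i => s i • u i) ≤
      Submodule.span ℝ (t.image u : Set F) := by
    rw [Module.Basis.constr_range, Submodule.span_le]
    rintro _ ⟨i, rfl⟩
    rcases hs i with h | h
    · simp [h]
    · simp only [h, one_smul]
      exact Submodule.subset_span (Finset.mem_coe.mpr (Finset.mem_image_of_mem u (by simp [ht, h])))
  rw [hsum, Nat.cast_le]
  exact (Submodule.finrank_mono hle).trans
    ((finrank_span_finset_le_card _).trans Finset.card_image_le)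

theorem le_nuclearNorm_of_convexOn {h : Matrix (Fin m) (Fin n) ℝ → ℝ}
    (hconv : ConvexOn ℝ (opUnitBall m n) h) (hrank : ∀ X ∈ opUnitBall m n, h X ≤ rankFn X)
    {X : Matrix (Fin m) (Fin n) ℝ} (hX : X ∈ opUnitBall m n) : h X ≤ nuclearNorm X := by
  obtain ⟨b, u, hTb, hu, hu', -⟩ := exists_singularValueDecomposition
    finrank_euclideanSpace_fin (Matrix.toEuclideanLin X)
  -- `D s` has the singular vectors of `X`, with the singular values replaced by `s`.
  let D : (Fin n → ℝ) → Matrix (Fin m) (Fin n) ℝ := fun s =>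
    Matrix.toEuclideanLin.symm (b.toBasis.constr ℝ fun i => s i • u i)
  have hDlin : ∀ s, Matrix.toEuclideanLin (D s) = b.toBasis.constr ℝ fun i => s i • u i :=
    fun s => LinearEquiv.apply_symm_apply _ _
  have hDball : ∀ s ∈ Set.Icc (0 : Fin n → ℝ) 1, D s ∈ opUnitBall m n := by
    intro s hs
    refine mem_opUnitBall_of_norm_apply_le fun x => ?_
    rw [hDlin]
    refine norm_constr_apply_le b (fun i j hij => ?_) (fun i => ?_) x
    · rw [inner_smul_left, inner_smul_right, hu i j hij, mul_zero, mul_zero]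
    · rw [norm_smul, Real.norm_of_nonneg (hs.1 i)]
      exact mul_le_one₀ (hs.2 i) (norm_nonneg _) (hu' i)
  have hDcomb : ∀ (s t : Fin n → ℝ) (a c : ℝ), D (a • s + c • t) = a • D s + c • D t := by
    intro s t a c
    refine Matrix.toEuclideanLin.injective (b.toBasis.ext fun i => ?_)
    rw [map_add, map_smul, map_smul, hDlin, hDlin, hDlin]
    simp only [LinearMap.add_apply, LinearMap.smul_apply, Module.Basis.constr_basis, Pi.add_apply,
      Pi.smul_apply, smul_eq_mul, add_smul, mul_smul]
  have hconv' : ConvexOn ℝ (Set.Icc 0 1) fun s => h (D s) := by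
    refine ⟨convex_Icc _ _, fun s hs t ht a c ha hc hac => ?_⟩
    simp only [hDcomb]
    exact hconv.2 (hDball s hs) (hDball t ht) ha hc hac
  have hDX : D (fun i => (Matrix.toEuclideanLin X).singularValues i) = X := by
    refine Matrix.toEuclideanLin.injective (b.toBasis.ext fun i => ?_)
    rw [hDlin, Module.Basis.constr_basis, b.coe_toBasis, hTb]
  have hvertex : ∀ s : Fin n → ℝ, (∀ i, s i = 0 ∨ s i = 1) → h (D s) ≤ ∑ i, s i := by
    intro s hs
    have hmem : s ∈ Set.Icc (0 : Fin n → ℝ) 1 :=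
      ⟨fun i => by rcases hs i with h | h <;> simp [h],
        fun i => by rcases hs i with h | h <;> simp [h]⟩
    refine (hrank _ (hDball s hmem)).trans ?_
    rw [rankFn, rank_eq_finrank_range_toEuclideanLin, hDlin]
    exact finrank_range_constr_smul_le b.toBasis u hs
  have hfinal := le_sum_of_convexOn_Icc hconv' hvertex
    (s := fun i : Fin n => (Matrix.toEuclideanLin X).singularValues i)
    ⟨fun i => LinearMap.singularValues_nonneg _ _, fun i =>
      singularValues_le_of_norm_apply_le zero_le_one
        (fun x => (norm_toEuclideanLin_apply_le hX x).trans_eq (one_mul _).symm) i⟩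
  rwa [hDX, ← nuclearNorm_eq_sum_fin] at hfinal

theorem isConvexEnvelopeOn_nuclearNorm :
    IsConvexEnvelopeOn (opUnitBall m n) rankFn nuclearNorm :=
  ⟨convexOn_nuclearNorm.subset (Set.subset_univ _) convex_opUnitBall,
    fun _ hX => nuclearNorm_le_rankFn hX,
    fun _ hconv hrank _ hX => le_nuclearNorm_of_convexOn hconv hrank hX⟩

end ConvexEnvelope

/-! ### Non-convexity of the rank and its constraint -/

section Rank

variable {m n : ℕ}

theorem rankFn_zero : rankFn (0 : Matrix (Fin m) (Fin n) ℝ) = 0 := by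
  simp [rankFn]

theorem rankFn_smul {c : ℝ} (hc : c ≠ 0) (X : Matrix (Fin m) (Fin n) ℝ) :
    rankFn (c • X) = rankFn X := by
  rw [rankFn, Matrix.rank_smul_of_mem_nonZeroDivisors X (mem_nonZeroDivisors_of_ne_zero hc), rankFn]

theorem rankFn_pos {X : Matrix (Fin m) (Fin n) ℝ} (hX : X ≠ 0) : 0 < rankFn X := by
  rw [rankFn, Nat.cast_pos, rank_eq_finrank_range_toEuclideanLin, Nat.pos_iff_ne_zero]
  intro h
  rw [Submodule.finrank_eq_zero, LinearMap.range_eq_bot, LinearEquiv.map_eq_zero_iff] at h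
  exact hX h

theorem single_ne_zero (i : Fin m) (j : Fin n) : Matrix.single i j (1 : ℝ) ≠ 0 := fun h => by
  simpa using congrFun (congrFun h i) j

theorem not_convexOn_rankFn (hm : 0 < m) (hn : 0 < n) :
    ¬ ConvexOn ℝ Set.univ (rankFn (m := m) (n := n)) := by
  intro h
  set X : Matrix (Fin m) (Fin n) ℝ := Matrix.single ⟨0, hm⟩ ⟨0, hn⟩ 1
  have hpos : 0 < rankFn X := rankFn_pos (single_ne_zero _ _)
  have h2 := h.2 (Set.mem_univ X) (Set.mem_univ 0) (one_half_pos (α := ℝ)).le one_half_pos.le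
    (add_halves 1)
  rw [smul_zero, add_zero, rankFn_smul (by norm_num), rankFn_zero, smul_zero, add_zero,
    smul_eq_mul] at h2
  linarith

/-- The set is symmetric under negation, so convexity would put the zero matrix in it. -/
theorem not_convex_feasible_rankFn {S : Matrix (Fin m) (Fin n) ℝ}
    (hS : (feasible rankFn S).Nonempty) : ¬ Convex ℝ (feasible rankFn S) := by
  intro h
  obtain ⟨X, hX⟩ := hS
  have hX' : (-1 : ℝ) • X ∈ feasible rankFn S := by
    simp only [feasible, Set.mem_ofPred_eq] at hX ⊢
    rwa [rankFn_smul (by norm_num)]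
  have h0 := h hX hX' (one_half_pos (α := ℝ)).le one_half_pos.le (add_halves 1)
  have hzero : (1 / 2 : ℝ) • X + (1 / 2 : ℝ) • (-1 : ℝ) • X = 0 := by
    rw [smul_smul, ← add_smul]
    norm_num
  rw [hzero, feasible, Set.mem_ofPred_eq, rankFn_zero] at h0
  exact absurd h0 (not_lt.mpr (Nat.cast_nonneg _))

end Rank

/-! ### Existence of minimisers and exactness of the penalty -/

section Penalty

variable {m n : ℕ}

theorem l1Norm_nonneg (X : Matrix (Fin m) (Fin n) ℝ) : 0 ≤ l1Norm X :=
  Finset.sum_nonneg fun _ _ => Finset.sum_nonneg fun _ _ => abs_nonneg _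

theorem l1Norm_smul {c : ℝ} (hc : 0 ≤ c) (X : Matrix (Fin m) (Fin n) ℝ) :
    l1Norm (c • X) = c * l1Norm X := by
  simp [l1Norm, Finset.mul_sum, abs_mul, abs_of_nonneg hc]

theorem l1Norm_add_le (X Y : Matrix (Fin m) (Fin n) ℝ) :
    l1Norm (X + Y) ≤ l1Norm X + l1Norm Y := by
  simp only [l1Norm, ← Finset.sum_add_distrib]
  exact Finset.sum_le_sum fun i _ => Finset.sum_le_sum fun j _ => abs_add_le _ _

theorem convexOn_l1Norm : ConvexOn ℝ Set.univ (l1Norm (m := m) (n := n)) := by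
  refine ⟨convex_univ, fun X _ Y _ a b ha hb _ => ?_⟩
  refine (l1Norm_add_le _ _).trans_eq ?_
  rw [l1Norm_smul ha, l1Norm_smul hb, smul_eq_mul, smul_eq_mul]

theorem continuous_l1Norm : Continuous (l1Norm (m := m) (n := n)) := by
  unfold l1Norm
  fun_prop

theorem abs_apply_le_l1Norm (X : Matrix (Fin m) (Fin n) ℝ) (i : Fin m) (j : Fin n) :
    |X i j| ≤ l1Norm X :=
  (Finset.single_le_sum (f := fun j => |X i j|) (fun _ _ => abs_nonneg _)
    (Finset.mem_univ j)).trans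
  (Finset.single_le_sum (f := fun i => ∑ j, |X i j|)
    (fun _ _ => Finset.sum_nonneg fun _ _ => abs_nonneg _) (Finset.mem_univ i))

theorem l1Norm_le_mul_nuclearNorm (X : Matrix (Fin m) (Fin n) ℝ) :
    l1Norm X ≤ (m * n) * nuclearNorm X := by
  refine (Finset.sum_le_sum fun i _ => Finset.sum_le_sum fun j _ =>
    abs_apply_le_nuclearNorm X i j).trans_eq ?_
  simp [mul_assoc]

theorem nuclearNorm_pos {X : Matrix (Fin m) (Fin n) ℝ} (hX : X ≠ 0) : 0 < nuclearNorm X := by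
  refine (nuclearNorm_nonneg X).lt_of_ne fun h => hX ?_
  ext i j
  exact abs_nonpos_iff.mp (h ▸ abs_apply_le_nuclearNorm X i j)

theorem isCompact_l1Norm_le (R : ℝ) : IsCompact {X : Matrix (Fin m) (Fin n) ℝ | l1Norm X ≤ R} := by
  have hbox : IsCompact
      {X : Matrix (Fin m) (Fin n) ℝ | ∀ i, X i ∈ {v | ∀ j, v j ∈ Set.Icc (-R) R}} :=
    isCompact_pi_infinite fun _ => isCompact_pi_infinite fun _ => isCompact_Icc
  refine hbox.of_isClosed_subset (isClosed_le continuous_l1Norm continuous_const) ?_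
  intro X hX i j
  exact abs_le.mp ((abs_apply_le_l1Norm X i j).trans hX)

/-- A continuous function that dominates the `ℓ¹` norm has a minimiser on every non-empty closed
set. -/
theorem exists_forall_le_of_l1Norm_le {f : Matrix (Fin m) (Fin n) ℝ → ℝ} (hf : Continuous f)
    (hle : ∀ X, l1Norm X ≤ f X) {C : Set (Matrix (Fin m) (Fin n) ℝ)} (hC : IsClosed C)
    (hne : C.Nonempty) : ∃ X ∈ C, ∀ Y ∈ C, f X ≤ f Y := by
  obtain ⟨Z, hZ⟩ := hne
  have hZ' : Z ∈ {X | l1Norm X ≤ f Z} ∩ C := ⟨hle Z, hZ⟩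
  obtain ⟨X, hX, hmin⟩ := ((isCompact_l1Norm_le (f Z)).inter_right hC).exists_isMinOn
    ⟨Z, hZ'⟩ hf.continuousOn
  refine ⟨X, hX.2, fun Y hY => ?_⟩
  rcases le_total (l1Norm Y) (f Z) with h | h
  · exact hmin ⟨h, hY⟩
  -- Outside the compact sublevel set, `f` is already at least `f Z`.
  · exact (hmin hZ').trans (h.trans (hle Y))

theorem continuous_penalty (S : Matrix (Fin m) (Fin n) ℝ) (t : ℝ) :
    Continuous fun X => penalty X S t :=
  continuous_l1Norm.add (continuous_const.mul
    (continuous_const.max (continuous_const.sub continuous_nuclearNorm)))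

theorem l1Norm_le_penalty (X S : Matrix (Fin m) (Fin n) ℝ) {t : ℝ} (ht : 0 ≤ t) :
    l1Norm X ≤ penalty X S t :=
  le_add_of_nonneg_right (mul_nonneg ht (le_max_left _ _))

theorem penalty_eq_l1Norm {X S : Matrix (Fin m) (Fin n) ℝ} (h : nuclearNorm S ≤ nuclearNorm X)
    (t : ℝ) : penalty X S t = l1Norm X := by
  rw [penalty, max_eq_left (sub_nonpos.mpr h), mul_zero, add_zero]

theorem tendsto_penalty_atTop {X S : Matrix (Fin m) (Fin n) ℝ}
    (h : nuclearNorm X < nuclearNorm S) : Tendsto (fun t => penalty X S t) atTop atTop :=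
  tendsto_atTop_add_const_left _ _
    (tendsto_id.atTop_mul_const (lt_max_of_lt_right (sub_pos.mpr h)))

theorem exists_isPenaltyMinimizer (S : Matrix (Fin m) (Fin n) ℝ) {t : ℝ} (ht : 0 ≤ t) :
    ∃ X, IsPenaltyMinimizer S t X := by
  obtain ⟨X, -, hX⟩ := exists_forall_le_of_l1Norm_le (continuous_penalty S t)
    (fun X => l1Norm_le_penalty X S ht) isClosed_univ ⟨S, Set.mem_univ S⟩
  exact ⟨X, fun Y => hX Y (Set.mem_univ Y)⟩

theorem feasible_nuclearNorm_nonempty (hm : 0 < m) (hn : 0 < n) (S : Matrix (Fin m) (Fin n) ℝ) :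
    (feasible nuclearNorm S).Nonempty := by
  set X : Matrix (Fin m) (Fin n) ℝ := Matrix.single ⟨0, hm⟩ ⟨0, hn⟩ 1
  have hX : 0 < nuclearNorm X := nuclearNorm_pos (single_ne_zero _ _)
  have hS := nuclearNorm_nonneg S
  refine ⟨((nuclearNorm S + 1) / nuclearNorm X) • X, ?_⟩
  rw [feasible, Set.mem_ofPred_eq, nuclearNorm_smul (by positivity), div_mul_cancel₀ _ hX.ne']
  exact lt_add_one _

theorem closure_feasible_nuclearNorm (hm : 0 < m) (hn : 0 < n) (S : Matrix (Fin m) (Fin n) ℝ) :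
    closure (feasible nuclearNorm S) = {X | nuclearNorm S ≤ nuclearNorm X} := by
  refine (closure_minimal (fun X hX => le_of_lt hX)
    (isClosed_le continuous_const continuous_nuclearNorm)).antisymm fun X hX => ?_
  -- Scaling up increases the nuclear norm strictly, except at zero, where any nonzero direction
  -- serves.
  obtain ⟨D, hXD⟩ : ∃ D : Matrix (Fin m) (Fin n) ℝ,
      ∀ e : ℝ, 0 < e → nuclearNorm X < nuclearNorm (X + e • D) := by
    rcases eq_or_ne X 0 with rfl | hX0
    · refine ⟨Matrix.single ⟨0, hm⟩ ⟨0, hn⟩ 1, fun e he => ?_⟩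
      rw [zero_add, nuclearNorm_zero]
      exact nuclearNorm_pos (smul_ne_zero he.ne' (single_ne_zero _ _))
    · refine ⟨X, fun e he => ?_⟩
      rw [show X + e • X = (1 + e) • X by rw [add_smul, one_smul], nuclearNorm_smul (by positivity)]
      exact lt_mul_of_one_lt_left (nuclearNorm_pos hX0) (by linarith)
  have hlim : Tendsto (fun e : ℝ => X + e • D) (𝓝[>] 0) (𝓝 X) := by
    have h : Continuous fun e : ℝ => X + e • D := by fun_prop
    have h' := h.tendsto 0
    rw [zero_smul, add_zero] at h'
    exact h'.mono_left nhdsWithin_le_nhds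
  refine mem_closure_of_tendsto hlim ?_
  filter_upwards [self_mem_nhdsWithin] with e he
  exact lt_of_le_of_lt hX (hXD e he)

/-- The solutions of the relaxed problem are the minimisers of the `ℓ¹` norm under the non-strict
constraint. -/
theorem mem_relaxedSolutions_iff (hm : 0 < m) (hn : 0 < n) {S X : Matrix (Fin m) (Fin n) ℝ} :
    X ∈ relaxedSolutions S ↔ nuclearNorm S ≤ nuclearNorm X ∧
      ∀ Y : Matrix (Fin m) (Fin n) ℝ, nuclearNorm S ≤ nuclearNorm Y → l1Norm X ≤ l1Norm Y := by
  rw [relaxedSolutions, Set.mem_ofPred_eq, closure_feasible_nuclearNorm hm hn, Set.mem_ofPred_eq]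
  refine and_congr_right fun hX => ⟨fun h Y hY => ?_, fun h => ⟨?_, fun c hc => ?_⟩⟩
  · have hsub : feasible nuclearNorm S ⊆ {Y | l1Norm X ≤ l1Norm Y} :=
      fun Z hZ => h.1 (Set.mem_image_of_mem _ hZ)
    have hY' : Y ∈ closure (feasible nuclearNorm S) := by
      rwa [closure_feasible_nuclearNorm hm hn]
    exact closure_minimal hsub (isClosed_le continuous_const continuous_l1Norm) hY'
  · rintro _ ⟨Z, hZ, rfl⟩
    exact h Z (le_of_lt hZ)
  · have hsub : feasible nuclearNorm S ⊆ {Y | c ≤ l1Norm Y} :=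
      fun Z hZ => hc (Set.mem_image_of_mem _ hZ)
    have hX' : X ∈ closure (feasible nuclearNorm S) := by
      rwa [closure_feasible_nuclearNorm hm hn]
    exact closure_minimal hsub (isClosed_le continuous_const continuous_l1Norm) hX'

theorem relaxedSolutions_nonempty (hm : 0 < m) (hn : 0 < n) (S : Matrix (Fin m) (Fin n) ℝ) :
    (relaxedSolutions S).Nonempty := by
  obtain ⟨X, hX, hmin⟩ := exists_forall_le_of_l1Norm_le continuous_l1Norm (fun _ => le_rfl)
    (isClosed_le continuous_const continuous_nuclearNorm :
      IsClosed {X : Matrix (Fin m) (Fin n) ℝ | nuclearNorm S ≤ nuclearNorm X})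
    ⟨S, le_refl (nuclearNorm S)⟩
  exact ⟨X, (mem_relaxedSolutions_iff hm hn).mpr ⟨hX, hmin⟩⟩

/-- The penalty is exact: for large parameters its minimisers satisfy the constraint. -/
theorem IsPenaltyMinimizer.nuclearNorm_le {S X : Matrix (Fin m) (Fin n) ℝ} {t : ℝ}
    (hX : IsPenaltyMinimizer S t X) (ht : (m * n : ℝ) < t) : nuclearNorm S ≤ nuclearNorm X := by
  by_contra! hlt
  have hgap : penalty X S t = l1Norm X + t * (nuclearNorm S - nuclearNorm X) := by
    rw [penalty, max_eq_right (sub_pos.mpr hlt).le]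
  rcases (nuclearNorm_nonneg X).eq_or_lt with h0 | hpos
  -- An `X` of nuclear norm zero cannot be scaled to the boundary; `S` itself is the competitor.
  · have hS := hX S
    rw [hgap, penalty_eq_l1Norm le_rfl, ← h0, sub_zero] at hS
    rw [← h0] at hlt
    have h1 := l1Norm_le_mul_nuclearNorm S
    have h2 := mul_lt_mul_of_pos_right ht hlt
    have h3 := l1Norm_nonneg X
    linarith
  -- Scaling by `c` reaches the boundary: the objective grows by `(c - 1) * l1Norm X`, while a
  -- penalty of `(c - 1) * t * nuclearNorm X` is saved.
  · set c := nuclearNorm S / nuclearNorm X with hc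
    have hc1 : 1 < c := (one_lt_div hpos).mpr hlt
    have hcX : c * nuclearNorm X = nuclearNorm S := div_mul_cancel₀ _ hpos.ne'
    have hY := hX (c • X)
    rw [hgap, penalty_eq_l1Norm (by rw [nuclearNorm_smul (by linarith), hcX]),
      l1Norm_smul (by linarith), ← hcX] at hY
    have h1 := l1Norm_le_mul_nuclearNorm X
    have h2 := mul_lt_mul_of_pos_right ht hpos
    have h3 : 0 < (c - 1) * (t * nuclearNorm X - l1Norm X) :=
      mul_pos (by linarith) (by linarith)
    linarith

theorem IsPenaltyMinimizer.mem_relaxedSolutions (hm : 0 < m) (hn : 0 < n)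
    {S X : Matrix (Fin m) (Fin n) ℝ} {t : ℝ} (hX : IsPenaltyMinimizer S t X)
    (ht : (m * n : ℝ) < t) : X ∈ relaxedSolutions S := by
  have hle := hX.nuclearNorm_le ht
  refine (mem_relaxedSolutions_iff hm hn).mpr ⟨hle, fun Y hY => ?_⟩
  have h := hX Y
  rwa [penalty_eq_l1Norm hle, penalty_eq_l1Norm hY] at h

end Penalty

end MergerRelaxation

theorem lemma1 (m n : ℕ) (hm : 0 < m) (hn : 0 < n) (S : Matrix (Fin m) (Fin n) ℝ) :
    -- the objective is convex; the rank and the rank constraint are not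
    ConvexOn ℝ Set.univ (MergerRelaxation.l1Norm (m := m) (n := n)) ∧
    ¬ ConvexOn ℝ Set.univ (MergerRelaxation.rankFn (m := m) (n := n)) ∧
    ((MergerRelaxation.feasible MergerRelaxation.rankFn S).Nonempty →
      ¬ Convex ℝ (MergerRelaxation.feasible MergerRelaxation.rankFn S)) ∧
    -- the nuclear norm is the convex envelope of the rank on the operator norm unit ball
    MergerRelaxation.IsConvexEnvelopeOn (MergerRelaxation.opUnitBall m n)
      MergerRelaxation.rankFn MergerRelaxation.nuclearNorm ∧
    -- the penalty vanishes where `‖X‖_* ≥ ‖S‖_*` and blows up elsewhere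
    (∀ X : Matrix (Fin m) (Fin n) ℝ,
      MergerRelaxation.nuclearNorm S ≤ MergerRelaxation.nuclearNorm X →
        ∀ t : ℝ, MergerRelaxation.penalty X S t = MergerRelaxation.l1Norm X) ∧
    (∀ X : Matrix (Fin m) (Fin n) ℝ,
      MergerRelaxation.nuclearNorm X < MergerRelaxation.nuclearNorm S →
        Tendsto (fun t : ℝ => MergerRelaxation.penalty X S t) atTop atTop) ∧
    -- the penalised problems have solutions, which approach the solutions of the relaxed problem
    (∀ t : ℝ, 0 ≤ t → ∃ X, MergerRelaxation.IsPenaltyMinimizer S t X) ∧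
    (MergerRelaxation.feasible MergerRelaxation.nuclearNorm S).Nonempty ∧
    (MergerRelaxation.relaxedSolutions S).Nonempty ∧
    ∃ v : ℝ,
      IsGLB (MergerRelaxation.l1Norm ''
        MergerRelaxation.feasible MergerRelaxation.nuclearNorm S) v ∧
      ∀ (t : ℕ → ℝ) (X : ℕ → Matrix (Fin m) (Fin n) ℝ),
        Tendsto t atTop atTop →
        (∀ k, MergerRelaxation.IsPenaltyMinimizer S (t k) (X k)) →
          (∀ᶠ k in atTop, MergerRelaxation.nuclearNorm S ≤ MergerRelaxation.nuclearNorm (X k)) ∧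
          Tendsto (fun k => MergerRelaxation.penalty (X k) S (t k)) atTop (𝓝 v) ∧
          Tendsto (fun k => MergerRelaxation.l1Norm (X k)) atTop (𝓝 v) ∧
          Tendsto X atTop (𝓝ˢ (MergerRelaxation.relaxedSolutions S)) := by
  open MergerRelaxation in
  refine ⟨convexOn_l1Norm, not_convexOn_rankFn hm hn, not_convex_feasible_rankFn,
    isConvexEnvelopeOn_nuclearNorm, fun X hX t => penalty_eq_l1Norm hX t,
    fun X hX => tendsto_penalty_atTop hX, fun t ht => exists_isPenaltyMinimizer S ht,
    feasible_nuclearNorm_nonempty hm hn S, relaxedSolutions_nonempty hm hn S, ?_⟩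
  obtain ⟨Z, hZ⟩ := MergerRelaxation.relaxedSolutions_nonempty hm hn S
  refine ⟨_, hZ.2, fun t X ht hX => ?_⟩
  -- By exactness, `X k` is a solution as soon as `t k` exceeds `m * n`.
  have hsol : ∀ᶠ k in atTop, X k ∈ MergerRelaxation.relaxedSolutions S :=
    (ht.eventually_gt_atTop _).mono fun k hk => (hX k).mem_relaxedSolutions hm hn hk
  have hfeas : ∀ᶠ k in atTop,
      MergerRelaxation.nuclearNorm S ≤ MergerRelaxation.nuclearNorm (X k) :=
    hsol.mono fun k hk => ((MergerRelaxation.mem_relaxedSolutions_iff hm hn).mp hk).1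
  have hval : ∀ᶠ k in atTop, MergerRelaxation.l1Norm (X k) = MergerRelaxation.l1Norm Z :=
    hsol.mono fun k hk => hk.2.unique hZ.2
  refine ⟨hfeas, tendsto_nhds_of_eventually_eq ?_, tendsto_nhds_of_eventually_eq hval,
    (tendsto_principal.mpr hsol).mono_right principal_le_nhdsSet⟩
  filter_upwards [hfeas, hval] with k hk hk'
  rw [MergerRelaxation.penalty_eq_l1Norm hk, hk']
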